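/- For elements $x,y,w$ of a group write $[x,y]=x^{-1}y^{-1}xy$ and $[x,y,w]=[[x,y],w]$, and let $e$ be the identity. Let $k\geq 1$ be an integer and let $G$ be a nilpotent group of class at most $k+1$. Let $p$ be a prime, $a>0$ an integer, and $y,z\in G$. Assume that \[ [z,y^{p^i},y]=[z,y^{p^i},z]=e\qquad\text{for all integers } i\geq a. \] Then for every integer $N\geq a+\left\lfloor\frac{k-1}{p-1}\right\rfloor$, \[ [z^{p^N},y]=[z,y]^{p^N}=[z,y^{p^N}]. \] -/

import Mathlib

/-- The group commutator `[x, y] = x⁻¹ y⁻¹ x y`, the convention for which `x y = y x [x, y]`.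
(Mathlib's `⁅x, y⁆` is `x y x⁻¹ y⁻¹`.) -/
def grpComm {G : Type*} [Group G] (x y : G) : G := x⁻¹ * y⁻¹ * x * y

/-- The left-normed triple commutator `[x, y, z] = [[x, y], z]`. -/
def grpComm₃ {G : Type*} [Group G] (x y z : G) : G := grpComm (grpComm x y) z

/-! In the subgroup generated by `y` and `z`, the hypothesis says that [z, y^n] is central for n =
p^i, i ≥ a. Let γ_j be the lower central series. Both [z^n, y] and [z, y^n] are polynomial sequences
in n, with Taylor expansions g(n) = g(1)^n ∏ x_i^C(n,i), x_i ∈ γ_{1+i}, i ≥ 2. So it suffices that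
C(p^N, i) kills γ_{1+i}. Bracketing [z, y^n] with fixed elements exhibits each x ∈ γ_j, j ≥ 3, as
g(1) for a polynomial g trivial at 0 and at every p^i, i ≥ a. Expanding g at a suitable p^M bounds
the exponent of γ_j by those of deeper terms (`pow_exponent_eq_one`). -/

theorem grpComm_mem_commutator {G : Type*} [Group G] {A B : Subgroup G} {x y : G}
    (hx : x ∈ A) (hy : y ∈ B) : grpComm x y ∈ ⁅A, B⁆ := by
  simpa [grpComm, commutatorElement_def] using
    Subgroup.commutator_mem_commutator (inv_mem hx) (inv_mem hy)

/-- The three subgroups lemma relative to a normal subgroup. -/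
theorem commutator_commutator_le_of_rotate {G : Type*} [Group G] {A B C N : Subgroup G}
    [N.Normal] (h1 : ⁅⁅B, C⁆, A⁆ ≤ N) (h2 : ⁅⁅C, A⁆, B⁆ ≤ N) : ⁅⁅A, B⁆, C⁆ ≤ N := by
  have key : ∀ K : Subgroup G, K ≤ N ↔ K.map (QuotientGroup.mk' N) = ⊥ := fun K => by
    rw [Subgroup.map_eq_bot_iff, QuotientGroup.ker_mk']
  rw [key, Subgroup.map_commutator, Subgroup.map_commutator] at *
  exact Subgroup.commutator_commutator_eq_bot_of_rotate h1 h2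

/-- The lower central series, indexed so that the terms of index `0` and `1` are the group. -/
def lcsFiltration (G : Type*) [Group G] (n : ℕ) : Subgroup G :=
  (⊤ : Subgroup G).lowerCentralSeries (n - 1)

instance lcsFiltration_normal {G : Type*} [Group G] (n : ℕ) : (lcsFiltration G n).Normal := by
  unfold lcsFiltration; infer_instance

theorem mem_lcsFiltration_one {G : Type*} [Group G] (x : G) : x ∈ lcsFiltration G 1 :=
  Subgroup.mem_top x

theorem lcsFiltration_antitone {G : Type*} [Group G] : Antitone (lcsFiltration G) := fun a b h =>
  (⊤ : Subgroup G).lowerCentralSeries_antitone (by omega)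

theorem lcsFiltration_succ {G : Type*} [Group G] {n : ℕ} (hn : 1 ≤ n) :
    lcsFiltration G (n + 1) = ⁅lcsFiltration G n, ⊤⁆ := by
  obtain ⟨n, rfl⟩ := Nat.exists_eq_add_of_le' hn
  rfl

theorem commutator_lcsFiltration_le {G : Type*} [Group G] (s r : ℕ) :
    ⁅lcsFiltration G s, lcsFiltration G r⁆ ≤ lcsFiltration G (s + r) := by
  rcases Nat.eq_zero_or_pos s with rfl | hs
  · rw [Nat.zero_add]; exact Subgroup.commutator_le_right _ _
  rcases Nat.eq_zero_or_pos r with rfl | hr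
  · exact Subgroup.commutator_le_left _ _
  induction r, hr using Nat.le_induction generalizing s with
  | base => rw [lcsFiltration_succ hs]; exact Subgroup.commutator_mono le_rfl le_top
  | succ r hr ih =>
    rw [lcsFiltration_succ hr, Subgroup.commutator_comm]
    refine commutator_commutator_le_of_rotate ?_ ?_
    · rw [Subgroup.commutator_comm ⊤, ← lcsFiltration_succ hs]
      exact (ih _ (by omega)).trans_eq (by congr 1; omega)
    · rw [show s + (r + 1) = s + r + 1 by omega, lcsFiltration_succ (n := s + r) (by omega)]
      exact Subgroup.commutator_mono (ih s hs) le_rfl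

theorem grpComm_mem_lcsFiltration {G : Type*} [Group G] {s r : ℕ} {x y : G}
    (hx : x ∈ lcsFiltration G s) (hy : y ∈ lcsFiltration G r) :
    grpComm x y ∈ lcsFiltration G (s + r) :=
  commutator_lcsFiltration_le s r (grpComm_mem_commutator hx hy)

/-! ### Polynomial sequences in the lower central filtration -/

/-- `PolySeqUpTo d s g` says that the iterated differences of `g` of every order `m ≤ d` take
values in the term of index `s + m` of the lower central filtration. -/
def PolySeqUpTo {G : Type*} [Group G] : ℕ → ℕ → (ℕ → G) → Prop
  | 0, s, g => ∀ n, g n ∈ lcsFiltration G s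
  | d + 1, s, g => (∀ n, g n ∈ lcsFiltration G s) ∧
      PolySeqUpTo d (s + 1) (fun n => (g n)⁻¹ * g (n + 1))

namespace PolySeqUpTo

variable {G : Type*} [Group G]

theorem mem {d s : ℕ} {g : ℕ → G} (hg : PolySeqUpTo d s g) (n : ℕ) : g n ∈ lcsFiltration G s := by
  cases d with
  | zero => exact hg n
  | succ d => exact hg.1 n

theorem of_succ {d s : ℕ} {g : ℕ → G} (hg : PolySeqUpTo (d + 1) s g) : PolySeqUpTo d s g := by
  induction d generalizing s g with
  | zero => exact hg.1
  | succ d ih => exact ⟨hg.1, ih hg.2⟩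

theorem anti {d s r : ℕ} (h : r ≤ s) {g : ℕ → G} (hg : PolySeqUpTo d s g) :
    PolySeqUpTo d r g := by
  induction d generalizing s r g with
  | zero => exact fun n => lcsFiltration_antitone h (hg n)
  | succ d ih => exact ⟨fun n => lcsFiltration_antitone h (hg.1 n), ih (by omega) hg.2⟩

theorem shift {d s : ℕ} {g : ℕ → G} (hg : PolySeqUpTo d s g) :
    PolySeqUpTo d s (fun n => g (n + 1)) := by
  induction d generalizing s g with
  | zero => exact fun n => hg (n + 1)
  | succ d ih => exact ⟨fun n => hg.1 (n + 1), ih hg.2⟩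

theorem one (d s : ℕ) : PolySeqUpTo d s (fun _ => (1 : G)) := by
  induction d generalizing s with
  | zero => exact fun n => one_mem _
  | succ d ih => exact ⟨fun n => one_mem _, by simpa using ih (s + 1)⟩

/-- The three closures need one joint induction: for example Δ(gh) = Δg [Δg, h] Δh already mixes
products and commutators. -/
theorem closure_properties (d : ℕ) :
    (∀ (s : ℕ) (g h : ℕ → G), PolySeqUpTo d s g → PolySeqUpTo d s h →
      PolySeqUpTo d s (fun n => g n * h n)) ∧
    (∀ (s : ℕ) (g : ℕ → G), PolySeqUpTo d s g → PolySeqUpTo d s (fun n => (g n)⁻¹)) ∧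
    (∀ (s r : ℕ) (g h : ℕ → G), PolySeqUpTo d s g → PolySeqUpTo d r h →
      PolySeqUpTo d (s + r) (fun n => grpComm (g n) (h n))) := by
  induction d with
  | zero =>
    exact ⟨fun s g h hg hh n => mul_mem (hg n) (hh n), fun s g hg n => inv_mem (hg n),
      fun s r g h hg hh n => grpComm_mem_lcsFiltration (hg n) (hh n)⟩
  | succ d ih =>
    obtain ⟨hmul, hinv, hcomm⟩ := ih
    refine ⟨fun s g h hg hh => ⟨fun n => mul_mem (hg.1 n) (hh.1 n), ?_⟩,
      fun s g hg => ⟨fun n => inv_mem (hg.1 n), ?_⟩,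
      fun s r g h hg hh => ⟨fun n => grpComm_mem_lcsFiltration (hg.1 n) (hh.1 n), ?_⟩⟩
    · convert hmul _ _ _ (hmul _ _ _ hg.2
        ((hcomm _ _ _ _ hg.2 hh.of_succ).anti (r := s + 1) (by omega))) hh.2 using 1
      funext n; simp only [grpComm]; group
    · have hD := hinv _ _ hg.2
      convert hmul _ _ _ hD ((hcomm _ _ _ _ hD (hinv _ _ hg.of_succ)).anti
        (r := s + 1) (by omega)) using 1
      funext n; simp only [grpComm]; group
    · have hX := hcomm _ _ _ _ hg.of_succ.shift hh.2
      have hC := hcomm _ _ _ _ hg.of_succ hh.of_succ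
      have h1 := (hcomm _ _ _ _ hX hC).anti (r := s + r + 1) (by omega)
      have h2 := (hcomm _ _ _ _ hC hg.2).anti (r := s + r + 1) (by omega)
      have h3 := (hcomm _ _ _ _ hg.2 hh.of_succ).anti (r := s + r + 1) (by omega)
      have h4 := (hcomm _ _ _ _ (hcomm _ _ _ _ hg.of_succ.shift hh.of_succ) hh.2).anti
        (r := s + r + 1) (by omega)
      rw [show s + (r + 1) = s + r + 1 from rfl] at hX
      convert hmul _ _ _ (hmul _ _ _ (hmul _ _ _ (hmul _ _ _ hX h1) h2) h3) h4 using 1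
      funext n; simp only [grpComm]; group

end PolySeqUpTo

/-- Polynomial sequences with respect to the lower central filtration shifted by `s`. -/
def PolySeq {G : Type*} [Group G] (s : ℕ) (g : ℕ → G) : Prop := ∀ d, PolySeqUpTo d s g

namespace PolySeq

variable {G : Type*} [Group G] {s r : ℕ} {g h : ℕ → G}

theorem mem (hg : PolySeq s g) (n : ℕ) : g n ∈ lcsFiltration G s := hg 0 n

theorem diff (hg : PolySeq s g) : PolySeq (s + 1) (fun n => (g n)⁻¹ * g (n + 1)) :=
  fun d => (hg (d + 1)).2

theorem of_diff (hg : ∀ n, g n ∈ lcsFiltration G s)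
    (hd : PolySeq (s + 1) (fun n => (g n)⁻¹ * g (n + 1))) : PolySeq s g
  | 0 => hg
  | d + 1 => ⟨hg, hd d⟩

theorem anti (hrs : r ≤ s) (hg : PolySeq s g) : PolySeq r g := fun d => (hg d).anti hrs

theorem mul (hg : PolySeq s g) (hh : PolySeq s h) : PolySeq s (fun n => g n * h n) :=
  fun d => (PolySeqUpTo.closure_properties d).1 _ _ _ (hg d) (hh d)

theorem inv (hg : PolySeq s g) : PolySeq s (fun n => (g n)⁻¹) :=
  fun d => (PolySeqUpTo.closure_properties d).2.1 _ _ (hg d)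

theorem comm (hg : PolySeq s g) (hh : PolySeq r h) :
    PolySeq (s + r) (fun n => grpComm (g n) (h n)) :=
  fun d => (PolySeqUpTo.closure_properties d).2.2 _ _ _ _ (hg d) (hh d)

theorem const {x : G} (hx : x ∈ lcsFiltration G s) : PolySeq s (fun _ => x) :=
  of_diff (fun _ => hx) fun d => by simpa using PolySeqUpTo.one d (s + 1)

theorem pow_choose {i : ℕ} {x : G} (hx : x ∈ lcsFiltration G (s + i)) :
    PolySeq s (fun n => x ^ n.choose i) := by
  induction i generalizing s with
  | zero => simpa using const hx
  | succ i ih =>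
    refine of_diff (fun n => pow_mem (lcsFiltration_antitone (by omega) hx) _) ?_
    convert ih (s := s + 1) (by convert hx using 2; omega) using 2 with n
    rw [Nat.choose_succ_succ', add_comm (n.choose i), pow_add, inv_mul_cancel_left]

theorem pow {x : G} (hx : x ∈ lcsFiltration G (s + 1)) : PolySeq s (fun n => x ^ n) := by
  simpa using pow_choose hx

theorem mem_of_eq_one_below {i : ℕ} (hg : PolySeq s g) (h1 : ∀ n < i, g n = 1) :
    g i ∈ lcsFiltration G (s + i) := by
  induction i generalizing s g with
  | zero => exact hg.mem 0
  | succ i ih =>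
    have := ih hg.diff fun n hn => by simp [h1 n (by omega), h1 (n + 1) (by omega)]
    rw [h1 i (by omega), inv_one, one_mul] at this
    convert this using 2; omega

theorem eq_one_of_eq_one_below {i : ℕ} (hg : PolySeq s g) (h1 : ∀ n < i, g n = 1)
    (hF : lcsFiltration G (s + i) = ⊥) (n : ℕ) : g n = 1 := by
  induction i generalizing s g n with
  | zero => simpa [← Subgroup.mem_bot, ← hF] using hg.mem n
  | succ i ih =>
    have hd := ih hg.diff (fun n hn => by simp [h1 n (by omega), h1 (n + 1) (by omega)])
      (by rw [← hF]; congr 1; omega)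
    induction n with
    | zero => exact h1 0 (by omega)
    | succ n ihn => simpa [ihn] using hd n

/-- If `g` vanishes below `i` and its Taylor coefficients of order `≥ i` are killed by the
binomial coefficients of `n`, then `g n = 1`. -/
theorem eq_one_of_pow_choose_eq_one {g : ℕ → G} {c i n : ℕ} (hF : lcsFiltration G c = ⊥) (hg : PolySeq s g)
    (h1 : ∀ m < i, g m = 1)
    (hn : ∀ j ≥ i, ∀ x ∈ lcsFiltration G (s + j), x ^ n.choose j = 1) : g n = 1 := by
  by_cases hc : c ≤ s + i
  · exact eq_one_of_eq_one_below hg h1 (le_bot_iff.1 (hF ▸ lcsFiltration_antitone hc)) n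
  have hi := mem_of_eq_one_below hg h1
  -- Divide off the Taylor term of order `i`, which is trivial at `n`.
  have := eq_one_of_pow_choose_eq_one (g := fun n => (g i ^ n.choose i)⁻¹ * g n)
    (i := i + 1) (n := n) hF ((pow_choose hi).inv.mul hg)
    (fun m hm => by
      rcases Nat.lt_succ_iff_lt_or_eq.1 hm with hm | rfl
      · simp [h1 m hm, Nat.choose_eq_zero_of_lt hm]
      · simp)
    (fun j hj => hn j (by omega))
  simpa [hn i le_rfl _ hi] using this
termination_by c - (s + i)
decreasing_by omega

theorem eq_pow_of_pow_choose_eq_one {c n : ℕ} (hF : lcsFiltration G c = ⊥) (hg : PolySeq s g)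
    (h0 : g 0 = 1)
    (hn : ∀ j ≥ 2, ∀ x ∈ lcsFiltration G (s + j), x ^ n.choose j = 1) : g n = g 1 ^ n := by
  have h1 : g 1 ∈ lcsFiltration G (s + 1) :=
    mem_of_eq_one_below hg fun m hm => by rwa [Nat.lt_one_iff.1 hm]
  have := eq_one_of_pow_choose_eq_one (i := 2) (n := n) hF ((pow h1).inv.mul hg)
    (fun m hm => by interval_cases m <;> simp [h0]) hn
  exact (inv_mul_eq_one.1 this).symm

end PolySeq

/-! ### Binomial coefficients of prime powers -/

/-- Take v = v_p(i): i C(p^N, i) is a multiple of p^N, and Bernoulli gives i ≥ p^v ≥ 1 + v(p-1). -/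
theorem pow_sub_dvd_choose_prime_pow {p i : ℕ} (hp : p.Prime) (hi : 1 ≤ i) (N : ℕ) :
    ∃ v, v * (p - 1) ≤ i - 1 ∧ p ^ (N - v) ∣ (p ^ N).choose i := by
  obtain ⟨v, m, hm, rfl⟩ := Nat.exists_eq_pow_mul_and_not_dvd (n := i) (by omega) p hp.ne_one
  refine ⟨v, ?_, ?_⟩
  · have h1 : 1 + v * (p - 1) ≤ (1 + (p - 1)) ^ v := by
      simpa using one_add_mul_le_pow (R := ℤ) (a := ((p - 1 : ℕ) : ℤ)) (by omega) v |> fun h => by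
        exact_mod_cast h
    rw [Nat.add_sub_cancel' hp.one_le] at h1
    have : p ^ v ≤ p ^ v * m := Nat.le_mul_of_pos_right _ (Nat.pos_of_ne_zero (by rintro rfl; simp at hm))
    omega
  · rcases le_total N v with h | h
    · simp [Nat.sub_eq_zero_of_le h]
    have h2 : p ^ N ∣ (p ^ N).choose (p ^ v * m) * (p ^ v * m) := by
      obtain ⟨j, hj⟩ := Nat.exists_eq_add_of_le' hi
      obtain ⟨n, hn⟩ := Nat.exists_eq_add_of_le' (Nat.one_le_pow N p hp.pos)
      rw [hj, hn, ← Nat.add_one_mul_choose_eq]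
      exact dvd_mul_right _ _
    have h3 : p ^ (N - v) ∣ (p ^ N).choose (p ^ v * m) * m := by
      refine Nat.dvd_of_mul_dvd_mul_left (pow_pos hp.pos v) ?_
      rwa [← pow_add, Nat.add_sub_cancel' h, mul_left_comm]
    exact (Nat.Coprime.pow_left _ ((Nat.Prime.coprime_iff_not_dvd hp).2 hm)).dvd_of_dvd_mul_right h3

theorem commutator_le_of_closure_pair_eq_top {G : Type*} [Group G] {R : Subgroup G} [R.Normal]
    {y z : G} (hgen : Subgroup.closure {y, z} = ⊤) (hR : grpComm z y ∈ R) :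
    ⁅(⊤ : Subgroup G), ⊤⁆ ≤ R := by
  have hyz : Commute (z : G ⧸ R) (y : G ⧸ R) := by
    have : ((y * z : G) : G ⧸ R)⁻¹ * ((z * y : G) : G ⧸ R) = 1 := by
      rw [← QuotientGroup.mk_inv, ← QuotientGroup.mk_mul, QuotientGroup.eq_one_iff]
      convert hR using 1
      simp [grpComm, mul_assoc]
    simpa [Commute, SemiconjBy] using (inv_mul_eq_one.1 this).symm
  have top_le : ∀ C : Subgroup (G ⧸ R), (y : G ⧸ R) ∈ C → (z : G ⧸ R) ∈ C →
      ∀ g : G, (g : G ⧸ R) ∈ C := fun C hy hz g => by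
    have : Subgroup.closure {y, z} ≤ C.comap (QuotientGroup.mk' R) := by
      rw [Subgroup.closure_le]
      rintro _ (rfl | rfl) <;> assumption
    exact this (hgen ▸ Subgroup.mem_top g)
  have central : ∀ u ∈ ({y, z} : Set G), ∀ g : G, Commute (u : G ⧸ R) (g : G ⧸ R) :=
    fun u hu g => Subgroup.mem_centralizer_singleton_iff.1
      (top_le (Subgroup.centralizer {(u : G ⧸ R)})
        (by rcases hu with rfl | rfl <;> rw [Subgroup.mem_centralizer_singleton_iff]
            exact hyz.symm.eq)
        (by rcases hu with rfl | rfl <;> rw [Subgroup.mem_centralizer_singleton_iff]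
            exact hyz.eq) g) |>.symm
  rw [Subgroup.commutator_le]
  intro g _ w _
  have hgw : Commute (g : G ⧸ R) (w : G ⧸ R) := Subgroup.mem_centralizer_singleton_iff.1
    (top_le (Subgroup.centralizer {(w : G ⧸ R)})
      (Subgroup.mem_centralizer_singleton_iff.2 (central y (by simp) w))
      (Subgroup.mem_centralizer_singleton_iff.2 (central z (by simp) w)) g)
  rw [← QuotientGroup.eq_one_iff, commutatorElement_def]
  simp only [QuotientGroup.mk_mul, QuotientGroup.mk_inv]
  rw [hgw.eq]; group

/-! ### Realizing commutators as values of polynomial sequences -/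

/-- The values at `1` of the polynomial sequences that vanish at `0` and take values in `Z`
on `T`. -/
def polySeqValues {G : Type*} [Group G] (s : ℕ) (T : Set ℕ) (Z : Subgroup G) : Subgroup G where
  carrier := {x | ∃ g : ℕ → G, PolySeq s g ∧ g 0 = 1 ∧ g 1 = x ∧ ∀ n ∈ T, g n ∈ Z}
  one_mem' := ⟨fun _ => 1, PolySeq.const (one_mem _), rfl, rfl, fun _ _ => one_mem _⟩
  mul_mem' := by
    rintro _ _ ⟨g, hg, hg0, rfl, hgT⟩ ⟨h, hh, hh0, rfl, hhT⟩
    exact ⟨_, hg.mul hh, by simp [hg0, hh0], rfl, fun n hn => mul_mem (hgT n hn) (hhT n hn)⟩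
  inv_mem' := by
    rintro _ ⟨g, hg, hg0, rfl, hgT⟩
    exact ⟨_, hg.inv, by simp [hg0], rfl, fun n hn => inv_mem (hgT n hn)⟩

section polySeqValues

variable {G : Type*} [Group G] {s : ℕ} {T : Set ℕ} {Z Z' : Subgroup G}

theorem grpComm_mem_polySeqValues {x w : G} (hx : x ∈ polySeqValues s T Z)
    (hZ : ∀ u ∈ Z, grpComm u w ∈ Z') : grpComm x w ∈ polySeqValues (s + 1) T Z' := by
  obtain ⟨g, hg, hg0, rfl, hgT⟩ := hx
  exact ⟨_, hg.comm (PolySeq.const (mem_lcsFiltration_one w)), by simp [hg0, grpComm], rfl,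
    fun n hn => hZ _ (hgT n hn)⟩

theorem polySeqValues_anti {r : ℕ} (h : r ≤ s) : polySeqValues s T Z ≤ polySeqValues r T Z := by
  rintro _ ⟨g, hg, hg'⟩
  exact ⟨g, hg.anti h, hg'⟩

instance polySeqValues_normal [hZ : Z.Normal] : (polySeqValues s T Z).Normal where
  conj_mem x hx w := by
    have h := grpComm_mem_polySeqValues (w := w⁻¹) (Z' := Z) hx fun u hu => by
      simpa [grpComm, mul_assoc] using mul_mem (inv_mem hu) (hZ.conj_mem u hu w)
    convert mul_mem hx (polySeqValues_anti s.le_succ h) using 1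
    simp [grpComm, mul_assoc]

theorem lcsFiltration_le_polySeqValues_succ (hF : lcsFiltration G (s + 1) ≤ polySeqValues s T Z)
    (hZ : ∀ u ∈ Z, ∀ w, grpComm u w ∈ Z') :
    lcsFiltration G (s + 2) ≤ polySeqValues (s + 1) T Z' := by
  rw [lcsFiltration_succ (n := s + 1) (by omega), Subgroup.commutator_le]
  intro x hx w _
  simpa [grpComm, commutatorElement_def] using
    grpComm_mem_polySeqValues (hF (inv_mem hx)) fun u hu => hZ u hu w⁻¹

end polySeqValues

/-! ### Exponents of the lower central terms -/

section exponents

variable {G : Type*} [Group G] {p a k : ℕ}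

theorem lcsFiltration_le_polySeqValues_bot {y z : G} (hgen : Subgroup.closure {y, z} = ⊤)
    (hc : ∀ i, a ≤ i → grpComm z (y ^ p ^ i) ∈ Subgroup.center G) (s : ℕ) (hs : 2 ≤ s) :
    lcsFiltration G (s + 1) ≤ polySeqValues s {n | ∃ i, a ≤ i ∧ n = p ^ i} ⊥ := by
  induction s, hs using Nat.le_induction with
  | base =>
    refine lcsFiltration_le_polySeqValues_succ (s := 1) (Z := Subgroup.center G) ?_ ?_
    · refine commutator_le_of_closure_pair_eq_top hgen
        -- Central on prime powers p^i, i ≥ a, so one further bracket makes it trivial there.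
        ⟨fun n => grpComm z (y ^ n), ?_, by simp [grpComm], by simp, ?_⟩
      · exact (PolySeq.const (mem_lcsFiltration_one z)).comm
          (PolySeq.pow (s := 0) (mem_lcsFiltration_one y))
      · rintro _ ⟨i, hi, rfl⟩
        exact hc i hi
    · intro u hu w
      rw [Subgroup.mem_bot, grpComm, mul_assoc, ← Subgroup.mem_center_iff.1 hu w]
      group
  | succ s hs ih =>
    refine lcsFiltration_le_polySeqValues_succ ih fun u hu w => ?_
    rw [Subgroup.mem_bot] at hu ⊢
    simp [hu, grpComm]

theorem pow_choose_eq_one_of_exponents (hp : p.Prime) (hF : lcsFiltration G (k + 2) = ⊥)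
    {s i N : ℕ} (hi : 2 ≤ i) (hN : a + (k - s) / (p - 1) ≤ N) {x : G}
    (hx : x ∈ lcsFiltration G (s + i))
    (hE : x ^ p ^ (a + (k + 1 - (s + i)) / (p - 1)) = 1) : x ^ (p ^ N).choose i = 1 := by
  by_cases hk : k + 2 ≤ s + i
  · have : x ∈ (⊥ : Subgroup G) := hF ▸ lcsFiltration_antitone hk hx
    rw [Subgroup.mem_bot.1 this, one_pow]
  obtain ⟨v, hv, hdvd⟩ := pow_sub_dvd_choose_prime_pow hp (i := i) (by omega) N
  have hp1 : 0 < p - 1 := Nat.sub_pos_of_lt hp.one_lt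
  -- The i - 1 steps of depth gained pay for the loss v ≤ (i-1)/(p-1).
  have h1 : (k + 1 - (s + i)) / (p - 1) + v ≤ (k - s) / (p - 1) := by
    rw [← Nat.add_mul_div_right _ _ hp1]
    exact Nat.div_le_div_right (by omega)
  obtain ⟨m, hm⟩ := (pow_dvd_pow p
    (show a + (k + 1 - (s + i)) / (p - 1) ≤ N - v by omega)).trans hdvd
  rw [hm, pow_mul, hE, one_pow]

/-- Descending induction on `j`: with x = g(1), the deeper Taylor terms die at p^M, M = a +
(k+1-j)/(p-1), leaving 1 = g(p^M) = x^(p^M). -/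
theorem pow_exponent_eq_one (hp : p.Prime) (hF : lcsFiltration G (k + 2) = ⊥) {y z : G}
    (hgen : Subgroup.closure {y, z} = ⊤)
    (hc : ∀ i, a ≤ i → grpComm z (y ^ p ^ i) ∈ Subgroup.center G) {j : ℕ} (hj : 3 ≤ j) {x : G}
    (hx : x ∈ lcsFiltration G j) : x ^ p ^ (a + (k + 1 - j) / (p - 1)) = 1 := by
  by_cases hk : k + 2 ≤ j
  · have : x ∈ (⊥ : Subgroup G) := hF ▸ lcsFiltration_antitone hk hx
    rw [Subgroup.mem_bot.1 this, one_pow]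
  obtain ⟨s, rfl⟩ : ∃ s, j = s + 1 := ⟨j - 1, by omega⟩
  obtain ⟨g, hg, hg0, rfl, hgT⟩ :=
    lcsFiltration_le_polySeqValues_bot hgen hc s (by omega) hx
  rw [← PolySeq.eq_pow_of_pow_choose_eq_one hF hg hg0]
  · exact Subgroup.mem_bot.1 (hgT _ ⟨_, Nat.le_add_right _ _, rfl⟩)
  · intro i hi u hu
    exact pow_choose_eq_one_of_exponents hp hF hi (by simp) hu
      (pow_exponent_eq_one hp hF hgen hc (by omega) hu)
termination_by k + 2 - j

theorem grpComm_pow_eq_of_closure_eq_top (hp : p.Prime) (hF : lcsFiltration G (k + 2) = ⊥)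
    {y z : G} (hgen : Subgroup.closure {y, z} = ⊤)
    (hc : ∀ i, a ≤ i → grpComm z (y ^ p ^ i) ∈ Subgroup.center G) {N : ℕ}
    (hN : a + (k - 1) / (p - 1) ≤ N) :
    grpComm (z ^ p ^ N) y = grpComm z y ^ p ^ N ∧
      grpComm z (y ^ p ^ N) = grpComm z y ^ p ^ N := by
  have hpow : ∀ i ≥ 2, ∀ x ∈ lcsFiltration G (1 + i), x ^ (p ^ N).choose i = 1 :=
    fun i hi x hx => pow_choose_eq_one_of_exponents hp hF hi hN hx
      (pow_exponent_eq_one hp hF hgen hc (by omega) hx)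
  have h1 : PolySeq 1 fun n => grpComm (z ^ n) y :=
    (PolySeq.pow (s := 0) (mem_lcsFiltration_one z)).comm (PolySeq.const (mem_lcsFiltration_one y))
  have h2 : PolySeq 1 fun n => grpComm z (y ^ n) :=
    (PolySeq.const (mem_lcsFiltration_one z)).comm (PolySeq.pow (s := 0) (mem_lcsFiltration_one y))
  exact ⟨by simpa using h1.eq_pow_of_pow_choose_eq_one hF (by simp [grpComm]) hpow,
    by simpa using h2.eq_pow_of_pow_choose_eq_one hF (by simp [grpComm]) hpow⟩

end exponents

theorem commute_of_grpComm_eq_one {G : Type*} [Group G] {x y : G} (h : grpComm x y = 1) :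
    Commute x y := by
  rw [grpComm, mul_assoc, ← mul_inv_rev, inv_mul_eq_one] at h
  exact h.symm

theorem mainTheorem11 {G : Type*} [Group G] [Group.IsNilpotent G] (k : ℕ) (hk : 1 ≤ k)
    (hG : Group.nilpotencyClass G ≤ k + 1) (p : ℕ) (hp : p.Prime) (a : ℕ) (ha : 0 < a) (y z : G)
    (h : ∀ i : ℕ, a ≤ i → grpComm₃ z (y ^ p ^ i) y = 1 ∧ grpComm₃ z (y ^ p ^ i) z = 1)
    (N : ℕ) (hN : a + (k - 1) / (p - 1) ≤ N) :
    grpComm (z ^ p ^ N) y = grpComm z y ^ p ^ N ∧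
      grpComm z y ^ p ^ N = grpComm z (y ^ p ^ N) := by
  let H := Subgroup.closure {y, z}
  let y' : H := ⟨y, Subgroup.subset_closure (by simp)⟩
  let z' : H := ⟨z, Subgroup.subset_closure (by simp)⟩
  have hgen : Subgroup.closure {y', z'} = ⊤ := by
    convert Subgroup.closure_closure_coe_preimage (k := {y, z}) using 2
    ext x; simp [y', z', H, Subtype.ext_iff]
  have hF : lcsFiltration H (k + 2) = ⊥ :=
    Subgroup.lowerCentralSeries_eq_bot_iff_nilpotencyClass_le.2
      ((Subgroup.nilpotencyClass_le H).trans hG)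
  have hc : ∀ i, a ≤ i → grpComm z' (y' ^ p ^ i) ∈ Subgroup.center H := by
    intro i hi
    have hle : Subgroup.closure {y', z'} ≤
        Subgroup.centralizer {grpComm z' (y' ^ p ^ i)} := by
      rw [Subgroup.closure_le]
      rintro _ (rfl | rfl) <;>
        rw [SetLike.mem_coe, Subgroup.mem_centralizer_singleton_iff] <;> refine Subtype.ext ?_
      · exact (commute_of_grpComm_eq_one (h i hi).1).symm.eq
      · exact (commute_of_grpComm_eq_one (h i hi).2).symm.eq
    rw [hgen] at hle
    exact Subgroup.mem_center_iff.2 fun g =>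
      Subgroup.mem_centralizer_singleton_iff.1 (hle (Subgroup.mem_top g))
  have key := grpComm_pow_eq_of_closure_eq_top hp hF hgen hc hN
  exact ⟨congrArg Subtype.val key.1, (congrArg Subtype.val key.2).symm⟩
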